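/- Let $M$ be a smooth manifold carrying a para-Hermitian structure $(g,J_M)$: $g$ is a pseudo-Riemannian metric, $J_M\in\Gamma(\mathrm{End}\,TM)$ satisfies $J_M^2=1$, has $\pm1$-eigenbundles $T^\pm M$ of equal rank which are closed under the Lie bracket, and $g(J_M\cdot,J_M\cdot)=-g(\cdot,\cdot)$. Let $(E,\langle\cdot,\cdot\rangle,[\cdot,\cdot],\rho)$ be a Courant algebroid over $M$ (with skew-symmetric bracket), i.e. $E\to M$ is a smooth real vector bundle with a symmetric non-degenerate pairing, a skew-symmetric $\mathbb R$-bilinear bracket on $\Gamma(E)$ and an anchor $\rho:E\to TM$ with dual $\rho^*:T^*M\to E$, $\langle\rho^*\mu,e\rangle=\mu(\rho(e))$, such that for all sections and all $f\in C^\infty(M)$: 1. $[[e_1,e_2],e_3]+\mathrm{c.p.}=\rho^*dT(e_1,e_2,e_3)$, where $T(e_1,e_2,e_3)=\tfrac16\langle[e_1,e_2],e_3\rangle+\mathrm{c.p.}$; 2. $\rho[e_1,e_2]=[\rho e_1,\rho e_2]$; 3. $[e_1,fe_2]=f[e_1,e_2]+(\rho(e_1)f)\,e_2-\tfrac12\langle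 e_1,e_2\rangle\rho^*df$; 4. $\rho(\rho^*df)=0$; 5. $\rho(e)\langle h_1,h_2\rangle=\langle[e,h_1],h_2\rangle+\langle h_1,[e,h_2]\rangle+\tfrac12\rho(h_2)\langle e,h_1\rangle+\tfrac12\rho(h_1)\langle e,h_2\rangle$. Assume that $E$ is exact, i.e. $0\to T^*M\xrightarrow{\rho^*}E\xrightarrow{\rho}TM\to0$ is exact, and almost para-Hermitian, i.e. equipped with $J\in\Gamma(\mathrm{End}\,E)$ with $J^2=1$, $\pm1$-eigenbundles $E_\pm$ of equal rank, and $\langle J\cdot,J\cdot\rangle=-\langle\cdot,\cdot\rangle$. Let $\mathrm{pr}_{E_\pm}$ be the projections of $E=E_+\oplus E_-$. Then: * There is a smooth bivector field $\pi$ on $M$ with $$\iota_\mu\pi=\rho(\mathrm{pr}_{E_-}(\rho^*\mu))=-\rho(\mathrm{pr}_{E_+}(\rho^*\mu))\qquad(\mu\in T^*M),\quad \iota_\mu\pi=\pi(\mu,\cdot).$$ * There are alternating forms $\phi\in\Lambda^3E_+^*$ and $\psi\in\Lambda^3E_-^*$ with $\phi(a,b,c)=\langle\mathrm{pr}_{E_-}[a,b],c\rangle$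 for $a,b,c\in\Gamma(E_+)$ and $\psi(a,b,c)=\langle\mathrm{pr}_{E_+}[a,b],c\rangle$ for $a,b,c\in\Gamma(E_-)$ (the obstructions to closure of $E_\pm$ under the bracket), and $\tfrac12[\pi,\pi]=\rho(\phi)+\rho(\psi)$, where $[\cdot,\cdot]$ is the Schouten bracket, normalized by $\tfrac12[\pi,\pi](df,dg,dh)=\pi(df,d(\pi(dg,dh)))+\mathrm{c.p.}$, and $\rho(\phi)(\mu,\nu,\kappa)=\phi(\rho^*\mu,\rho^*\nu,\rho^*\kappa)$, the forms being extended by zero on the other eigenbundle. * If $E$ is para-Hermitian, i.e. $\Gamma(E_+)$ and $\Gamma(E_-)$ are both closed under the bracket of $E$, then $\pi$ is Poisson: $[\pi,\pi]=0$. * If $E$ is para-holomorphic, i.e. para-Hermitian with $\rho\circ J=J_M\circ\rho$, then $\pi=0$. -/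

import Mathlib

open Bundle Manifold VectorField
open scoped ContDiff Topology

noncomputable section

namespace CourantGeometry

/-! ### Metrics and para-complex structures on a vector bundle -/

section VectorBundles

variable {M : Type*} (n : ℕ)
  [TopologicalSpace M] [ChartedSpace (EuclideanSpace ℝ (Fin n)) M]
  (F : Type*) [NormedAddCommGroup F] [NormedSpace ℝ F]
  (E : M → Type*) [∀ x, AddCommGroup (E x)] [∀ x, Module ℝ (E x)]
  [∀ x, TopologicalSpace (E x)] [TopologicalSpace (TotalSpace F E)]
  [∀ x, IsTopologicalAddGroup (E x)] [∀ x, ContinuousSMul ℝ (E x)]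
  [FiberBundle F E] [VectorBundle ℝ F E]

/-- A pseudo-Riemannian metric on the vector bundle `E`: a smooth section of `E* ⊗ E*` which is
symmetric and non-degenerate in each fibre. -/
structure BundleMetric where
  /-- the pairing `⟨·,·⟩` in the fibre over `x` -/
  inner (x : M) : E x →L[ℝ] E x →L[ℝ] ℝ
  symm (x : M) (v w : E x) : inner x v w = inner x w v
  nondegenerate (x : M) (v : E x) : (∀ w : E x, inner x v w = 0) → v = 0
  contMDiff : ContMDiff (𝓡 n) ((𝓡 n).prod 𝓘(ℝ, F →L[ℝ] F →L[ℝ] ℝ)) ∞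
    (fun x ↦ TotalSpace.mk' (F →L[ℝ] F →L[ℝ] ℝ) x (inner x))

/-- A para-complex structure on the vector bundle `E`: a smooth section `J` of `End E` with
`J ^ 2 = 1` whose two eigenbundles have the same rank. -/
structure ParaComplexStructure where
  /-- the endomorphism `J` of the fibre over `x` -/
  toFun (x : M) : E x →L[ℝ] E x
  sq_eq_id (x : M) (v : E x) : toFun x (toFun x v) = v
  finrank_eq (x : M) :
    Module.finrank ℝ (Module.End.eigenspace (toFun x : E x →ₗ[ℝ] E x) 1) =
      Module.finrank ℝ (Module.End.eigenspace (toFun x : E x →ₗ[ℝ] E x) (-1))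
  contMDiff : ContMDiff (𝓡 n) ((𝓡 n).prod 𝓘(ℝ, F →L[ℝ] F)) ∞
    (fun x ↦ TotalSpace.mk' (F →L[ℝ] F) x (toFun x))

variable {n F E}

/-- An almost para-Hermitian structure on a metric vector bundle: a para-complex structure `J` with
`⟨J ·, J ·⟩ = -⟨·,·⟩`. -/
structure AlmostParaHermitianStructure (g : BundleMetric n F E) extends
    ParaComplexStructure n F E where
  compatible (x : M) (v w : E x) : g.inner x (toFun x v) (toFun x w) = - g.inner x v w

namespace ParaComplexStructure

/-- The projection onto the `+1`-eigenbundle along the `-1`-eigenbundle. -/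
def prPlus (J : ParaComplexStructure n F E) (x : M) : E x →L[ℝ] E x :=
  (1 / 2 : ℝ) • (ContinuousLinearMap.id ℝ (E x) + J.toFun x)

/-- The projection onto the `-1`-eigenbundle along the `+1`-eigenbundle. -/
def prMinus (J : ParaComplexStructure n F E) (x : M) : E x →L[ℝ] E x :=
  (1 / 2 : ℝ) • (ContinuousLinearMap.id ℝ (E x) - J.toFun x)

/-- `s` is a section of the `+1`-eigenbundle. -/
def IsPlus (J : ParaComplexStructure n F E) (s : ∀ x, E x) : Prop := ∀ x, J.toFun x (s x) = s x

/-- `s` is a section of the `-1`-eigenbundle. -/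
def IsMinus (J : ParaComplexStructure n F E) (s : ∀ x, E x) : Prop := ∀ x, J.toFun x (s x) = - s x

end ParaComplexStructure

namespace BundleMetric

/-- The bundle isomorphism `β : E → E*`, `β v = ⟨v, ·⟩`, is bijective. -/
theorem inner_bijective [FiniteDimensional ℝ F] (g : BundleMetric n F E) (x : M) :
    Function.Bijective (g.inner x : E x →ₗ[ℝ] (E x →L[ℝ] ℝ)) := by
  have e : E x ≃L[ℝ] F := (trivializationAt F E x).continuousLinearEquivAt ℝ x
    (FiberBundle.mem_baseSet_trivializationAt F E x)
  have : FiniteDimensional ℝ (E x) := LinearEquiv.finiteDimensional e.symm.toLinearEquiv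
  have : T2Space (E x) := e.symm.toHomeomorph.t2Space
  have hinj : Function.Injective (g.inner x : E x →ₗ[ℝ] (E x →L[ℝ] ℝ)) := by
    rw [injective_iff_map_eq_zero]
    intro v hv
    refine g.nondegenerate x v fun w ↦ ?_
    have := congrArg (fun l : E x →L[ℝ] ℝ ↦ l w) hv
    simpa using this
  have e' : (E x →ₗ[ℝ] ℝ) ≃ₗ[ℝ] (E x →L[ℝ] ℝ) := LinearMap.toContinuousLinearMap
  have : FiniteDimensional ℝ (E x →L[ℝ] ℝ) := LinearEquiv.finiteDimensional e'
  have hd : Module.finrank ℝ (E x) = Module.finrank ℝ (E x →L[ℝ] ℝ) := by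
    rw [← e'.finrank_eq]
    exact (Subspace.dual_finrank_eq (K := ℝ) (V := E x)).symm
  exact ⟨hinj, (LinearMap.injective_iff_surjective_of_finrank_eq_finrank hd).1 hinj⟩

/-- The bundle isomorphism `β : E → E*`, `β v = ⟨v, ·⟩`, in the fibre over `x`. -/
def beta [FiniteDimensional ℝ F] (g : BundleMetric n F E) (x : M) :
    E x ≃ₗ[ℝ] (E x →L[ℝ] ℝ) :=
  LinearEquiv.ofBijective (g.inner x : E x →ₗ[ℝ] (E x →L[ℝ] ℝ)) (g.inner_bijective x)

/-- The dual `ρ* = β⁻¹ ∘ ρᵗ : T*M → E` of a fibre map `ρ : E → TM` with respect to the metric. -/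
def dualMap [FiniteDimensional ℝ F] (g : BundleMetric n F E) (x : M)
    (ρ : E x →L[ℝ] TangentSpace (𝓡 n) x) :
    (TangentSpace (𝓡 n) x →L[ℝ] ℝ) →ₗ[ℝ] E x where
  toFun μ := (g.beta x).symm (μ.comp ρ)
  map_add' μ ν := by rw [ContinuousLinearMap.add_comp, map_add]
  map_smul' c μ := by rw [ContinuousLinearMap.smul_comp, map_smul, RingHom.id_apply]

/-- The defining property `⟨ρ* μ, e⟩ = μ (ρ e)`. -/
theorem inner_dualMap [FiniteDimensional ℝ F] (g : BundleMetric n F E) (x : M)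
    (ρ : E x →L[ℝ] TangentSpace (𝓡 n) x) (μ : TangentSpace (𝓡 n) x →L[ℝ] ℝ) (e : E x) :
    g.inner x (g.dualMap x ρ μ) e = μ (ρ e) := by
  have h : g.beta x ((g.beta x).symm (μ.comp ρ)) = μ.comp ρ := LinearEquiv.apply_symm_apply _ _
  exact congrArg (fun l : E x →L[ℝ] ℝ ↦ l e) h

end BundleMetric

end VectorBundles

/-! ### Functions, sections and vector fields -/

section Calculus

variable {M : Type*} {n : ℕ}
  [TopologicalSpace M] [ChartedSpace (EuclideanSpace ℝ (Fin n)) M]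
  {F : Type*} [NormedAddCommGroup F] [NormedSpace ℝ F]
  {E : M → Type*} [∀ x, AddCommGroup (E x)] [∀ x, Module ℝ (E x)]
  [∀ x, TopologicalSpace (E x)] [TopologicalSpace (TotalSpace F E)]
  [FiberBundle F E] [VectorBundle ℝ F E]

variable (n) in
/-- The differential `df` at `x` of a function `f` on `M`. -/
def differential (f : M → ℝ) (x : M) : TangentSpace (𝓡 n) x →L[ℝ] ℝ :=
  mfderiv (𝓡 n) 𝓘(ℝ, ℝ) f x

/-- The product of a smooth function and a smooth section. -/
def funSMul (f : C^∞⟮𝓡 n, M; ℝ⟯) (s : Cₛ^∞⟮𝓡 n; F, E⟯) : Cₛ^∞⟮𝓡 n; F, E⟯ where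
  toFun x := f x • s x
  contMDiff_toFun := f.contMDiff.smul_section s.contMDiff

/-- A para-complex structure on `TM` is integrable if the sections of each of the eigenbundles
`T⁺M` and `T⁻M` are closed under the Lie bracket of vector fields. -/
def IsIntegrableOnTangent [IsManifold (𝓡 n) ∞ M]
    (J : ParaComplexStructure n (EuclideanSpace ℝ (Fin n))
      (TangentSpace (𝓡 n) : M → Type _)) : Prop :=
  ∀ X Y : Cₛ^∞⟮𝓡 n; EuclideanSpace ℝ (Fin n), (TangentSpace (𝓡 n) : M → Type _)⟯,
    (J.IsPlus X → J.IsPlus Y → J.IsPlus (mlieBracket (𝓡 n) X Y)) ∧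
    (J.IsMinus X → J.IsMinus Y → J.IsMinus (mlieBracket (𝓡 n) X Y))

end Calculus

/-! ### Bivector fields and the Schouten bracket -/

section Bivectors

variable {M : Type*} (n : ℕ)
  [TopologicalSpace M] [ChartedSpace (EuclideanSpace ℝ (Fin n)) M] [IsManifold (𝓡 n) ∞ M]

set_option maxSynthPendingDepth 3 in
variable (M) in
/-- A smooth bivector field on `M`, as a smooth family of alternating bilinear forms on the
cotangent spaces; `ι_μ π = π(μ, ·)`. -/
structure BivectorField where
  /-- the alternating bilinear form on the cotangent space at `x` -/
  toFun (x : M) :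
    (TangentSpace (𝓡 n) x →L[ℝ] ℝ) →L[ℝ] (TangentSpace (𝓡 n) x →L[ℝ] ℝ) →L[ℝ] ℝ
  alternating (x : M) (μ : TangentSpace (𝓡 n) x →L[ℝ] ℝ) : toFun x μ μ = 0
  contMDiff : ContMDiff (𝓡 n)
    ((𝓡 n).prod 𝓘(ℝ, (EuclideanSpace ℝ (Fin n) →L[ℝ] ℝ) →L[ℝ]
      (EuclideanSpace ℝ (Fin n) →L[ℝ] ℝ) →L[ℝ] ℝ)) ∞
    (fun x ↦ TotalSpace.mk' ((EuclideanSpace ℝ (Fin n) →L[ℝ] ℝ) →L[ℝ]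
      (EuclideanSpace ℝ (Fin n) →L[ℝ] ℝ) →L[ℝ] ℝ)
      (E := fun x : M ↦ (TangentSpace (𝓡 n) x →L[ℝ] ℝ) →L[ℝ]
        (TangentSpace (𝓡 n) x →L[ℝ] ℝ) →L[ℝ] ℝ) x (toFun x))

variable {n}

/-- The function `P(df, dg)`. -/
def BivectorField.onFunctions (P : BivectorField M n) (f g : M → ℝ) : M → ℝ :=
  fun x ↦ P.toFun x (differential n f x) (differential n g x)

/-- The Schouten bracket `[P, Q]` of two bivector fields. It is a trivector field, and is given here
as a triderivation, i.e. by the functions `[P, Q](df, dg, dh)`, which determine it. The sign is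
the one of the extension of the Lie bracket to multivector fields with `[X, f] = X f`,
`[σ, τ] = -(-1) ^ ((|σ| - 1) (|τ| - 1)) [τ, σ]` and
`[σ, τ ∧ ξ] = [σ, τ] ∧ ξ + (-1) ^ ((|σ| - 1) |τ|) τ ∧ [σ, ξ]`. -/
def schoutenBracket (P Q : BivectorField M n) (f g h : M → ℝ) : M → ℝ := fun x ↦
  P.onFunctions f (Q.onFunctions g h) x + Q.onFunctions f (P.onFunctions g h) x +
  (P.onFunctions g (Q.onFunctions h f) x + Q.onFunctions g (P.onFunctions h f) x) +
  (P.onFunctions h (Q.onFunctions f g) x + Q.onFunctions h (P.onFunctions f g) x)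

/-- A bivector field `π` is Poisson if `[π, π] = 0`. -/
def BivectorField.IsPoisson (P : BivectorField M n) : Prop :=
  ∀ (f g h : C^∞⟮𝓡 n, M; ℝ⟯) (x : M), schoutenBracket P P f g h x = 0

end Bivectors

/-! ### Courant algebroids -/

section Courant

variable {M : Type*} (n : ℕ)
  [TopologicalSpace M] [ChartedSpace (EuclideanSpace ℝ (Fin n)) M] [IsManifold (𝓡 n) ∞ M]
  (F : Type*) [NormedAddCommGroup F] [NormedSpace ℝ F] [FiniteDimensional ℝ F]
  (E : M → Type*) [∀ x, AddCommGroup (E x)] [∀ x, Module ℝ (E x)]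
  [∀ x, TopologicalSpace (E x)] [TopologicalSpace (TotalSpace F E)]
  [∀ x, IsTopologicalAddGroup (E x)] [∀ x, ContinuousSMul ℝ (E x)]
  [FiberBundle F E] [VectorBundle ℝ F E] [ContMDiffVectorBundle ∞ F E (𝓡 n)]

/-- A Courant algebroid structure on `E`, with a skew-symmetric bracket. In the axioms,
`ρ* (dₓ f) = β⁻¹ (d_E f)` and `d_E f (e) = ρ(e) f = df (ρ e)`. -/
structure CourantAlgebroid extends BundleMetric n F E where
  /-- the anchor `ρ : E → TM` -/
  anchor (x : M) : E x →L[ℝ] TangentSpace (𝓡 n) x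
  contMDiff_anchor : ContMDiff (𝓡 n)
    ((𝓡 n).prod 𝓘(ℝ, F →L[ℝ] EuclideanSpace ℝ (Fin n))) ∞
    (fun x ↦ TotalSpace.mk' (F →L[ℝ] EuclideanSpace ℝ (Fin n))
      (E := fun x ↦ E x →L[ℝ] TangentSpace (𝓡 n) x) x (anchor x))
  /-- the bracket of sections -/
  bracket : Cₛ^∞⟮𝓡 n; F, E⟯ →ₗ[ℝ] Cₛ^∞⟮𝓡 n; F, E⟯ →ₗ[ℝ] Cₛ^∞⟮𝓡 n; F, E⟯
  bracket_skew (a b : Cₛ^∞⟮𝓡 n; F, E⟯) : bracket a b = - bracket b a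
  jacobi (a b c : Cₛ^∞⟮𝓡 n; F, E⟯) (x : M) :
    (bracket (bracket a b) c + bracket (bracket b c) a + bracket (bracket c a) b) x =
      toBundleMetric.dualMap x (anchor x) (differential n (fun y ↦ (1 / 6 : ℝ) *
        (inner y (bracket a b y) (c y) + inner y (bracket b c y) (a y) +
          inner y (bracket c a y) (b y))) x)
  anchor_bracket (a b : Cₛ^∞⟮𝓡 n; F, E⟯) (x : M) :
    anchor x (bracket a b x) =
      mlieBracket (𝓡 n) (fun y ↦ anchor y (a y)) (fun y ↦ anchor y (b y)) x
  leibniz (a b : Cₛ^∞⟮𝓡 n; F, E⟯) (f : C^∞⟮𝓡 n, M; ℝ⟯) (x : M) :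
    bracket a (funSMul f b) x =
      f x • bracket a b x + differential n f x (anchor x (a x)) • b x -
        ((1 / 2 : ℝ) * inner x (a x) (b x)) •
          toBundleMetric.dualMap x (anchor x) (differential n f x)
  anchor_dual (f : C^∞⟮𝓡 n, M; ℝ⟯) (x : M) :
    anchor x (toBundleMetric.dualMap x (anchor x) (differential n f x)) = 0
  metric_invariant (e a b : Cₛ^∞⟮𝓡 n; F, E⟯) (x : M) :
    differential n (fun y ↦ inner y (a y) (b y)) x (anchor x (e x)) =
      inner x (bracket e a x) (b x) + inner x (a x) (bracket e b x) +
      (1 / 2 : ℝ) * differential n (fun y ↦ inner y (e y) (a y)) x (anchor x (b x)) +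
      (1 / 2 : ℝ) * differential n (fun y ↦ inner y (e y) (b y)) x (anchor x (a x))

variable {n F E}

namespace CourantAlgebroid

/-- The map `ρ* : T*M → E` dual to the anchor under the pairing. -/
def coanchor (A : CourantAlgebroid n F E) (x : M) :
    (TangentSpace (𝓡 n) x →L[ℝ] ℝ) →ₗ[ℝ] E x :=
  A.toBundleMetric.dualMap x (A.anchor x)

/-- Exactness of `0 → T*M → E → TM → 0`. -/
def IsExact (A : CourantAlgebroid n F E) : Prop :=
  ∀ x, Function.Injective (A.coanchor x) ∧ Function.Exact (A.coanchor x) (A.anchor x) ∧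
    Function.Surjective (A.anchor x)

/-- An almost para-Hermitian algebroid is para-Hermitian if the sections of both eigenbundles are
closed under the bracket. -/
def IsParaHermitian (A : CourantAlgebroid n F E)
    (J : AlmostParaHermitianStructure A.toBundleMetric) : Prop :=
  ∀ a b : Cₛ^∞⟮𝓡 n; F, E⟯,
    (J.IsPlus a → J.IsPlus b → J.IsPlus (A.bracket a b)) ∧
    (J.IsMinus a → J.IsMinus b → J.IsMinus (A.bracket a b))

/-- A para-Hermitian algebroid over a manifold with para-complex structure `K` on `TM` is
para-holomorphic if `ρ ∘ J = K ∘ ρ`. -/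
def IsParaHolomorphic (A : CourantAlgebroid n F E)
    (J : AlmostParaHermitianStructure A.toBundleMetric)
    (K : ParaComplexStructure n (EuclideanSpace ℝ (Fin n))
      (TangentSpace (𝓡 n) : M → Type _)) : Prop :=
  A.IsParaHermitian J ∧ ∀ (x : M) (e : E x), A.anchor x (J.toFun x e) = K.toFun x (A.anchor x e)

/-- `φ` is the obstruction to integrability of `E₊`: it is the section of `Λ³ E₊* ⊆ Λ³ E*` (the
forms annihilated by contraction with `E₋`) with
`φ(a, b, c) = ⟨pr₋ [a, b], c⟩` on sections of `E₊`. -/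
def IsPlusObstruction (A : CourantAlgebroid n F E)
    (J : AlmostParaHermitianStructure A.toBundleMetric) (φ : ∀ x, E x [⋀^Fin 3]→ₗ[ℝ] ℝ) : Prop :=
  (∀ (x : M) (u v w : E x), J.toFun x u = - u → φ x ![u, v, w] = 0) ∧
  ∀ a b c : Cₛ^∞⟮𝓡 n; F, E⟯, J.IsPlus a → J.IsPlus b → J.IsPlus c →
    ∀ x, φ x ![a x, b x, c x] = A.inner x (J.prMinus x (A.bracket a b x)) (c x)

/-- `ψ` is the obstruction to integrability of `E₋`: it is the section of `Λ³ E₋* ⊆ Λ³ E*` (the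
forms annihilated by contraction with `E₊`) with
`ψ(a, b, c) = ⟨pr₊ [a, b], c⟩` on sections of `E₋`. -/
def IsMinusObstruction (A : CourantAlgebroid n F E)
    (J : AlmostParaHermitianStructure A.toBundleMetric) (ψ : ∀ x, E x [⋀^Fin 3]→ₗ[ℝ] ℝ) : Prop :=
  (∀ (x : M) (u v w : E x), J.toFun x u = u → ψ x ![u, v, w] = 0) ∧
  ∀ a b c : Cₛ^∞⟮𝓡 n; F, E⟯, J.IsMinus a → J.IsMinus b → J.IsMinus c →
    ∀ x, ψ x ![a x, b x, c x] = A.inner x (J.prPlus x (A.bracket a b x)) (c x)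

/-- The value on `(μ, ν, κ)` of the trivector `ρ(φ)` at `x`, where a 3-form `φ` on `E` is regarded
as an element of `Λ³ E` through `⟨·,·⟩` and pushed forward by the anchor. -/
def anchorPush (A : CourantAlgebroid n F E) (φ : ∀ x, E x [⋀^Fin 3]→ₗ[ℝ] ℝ) (x : M)
    (μ ν κ : TangentSpace (𝓡 n) x →L[ℝ] ℝ) : ℝ :=
  φ x ![A.coanchor x μ, A.coanchor x ν, A.coanchor x κ]

end CourantAlgebroid

end Courant

end CourantGeometry

end

/-!
Write `D f = ρ* df`, `a = a₊ + a₋` for the splitting `E = E₊ ⊕ E₋`, and `{f, h} = π(df, dh)`.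

Exactness gives `ρ ρ* = 0`, so `ρ(pr₋ ρ* μ) = -ρ(pr₊ ρ* μ)`; and `π(μ, ν) = -⟨ρ* ν, J ρ* μ⟩ / 2` is
alternating because `⟨·, J ·⟩` is. In terms of functions, `ρ((D f)₋) h = {f, h}` and
`ρ((D f)₊) h = -{f, h}`. Smoothness of `π` reduces to smoothness of `ρ*`, hence to that of the
inverse of the isomorphism `E → E*` given by the metric (`contMDiffAt_of_hom_apply`,
`BundleMetric.contMDiffAt_of_inner`).

The eigenbundles are isotropic. Hence the error terms in the Leibniz rule and in the invariance of
the metric vanish for `(a, b, c) ↦ ⟨[a₊, b₊], c₊⟩`, which is therefore alternating and linear over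
functions, and so comes from a form on the fibres (`eq_zero_of_section_eq_zero`,
`CourantAlgebroid.exists_plusForm`); this is `φ`. Replacing `J` by `-J` exchanges the eigenbundles
and gives `ψ`.

The identity for the Schouten bracket rests on two facts. First, `ρ` intertwines the bracket with
the commutator of derivations (`CourantAlgebroid.act_bracket`), for which one needs that the Lie
bracket of vector fields acts on functions as the commutator (`differential_mlieBracket`). Second,
the invariance of the metric then yields `⟨[a, D f], c⟩ = ρ(c)(ρ(a) f) / 2`
(`CourantAlgebroid.inner_bracket_grad`). For `a = D f`, `b = D h`, `c = D k`, the three pairings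
`⟨[a₊, b], c₊⟩`, `⟨[a, b₋], c₋⟩` and `⟨[a₊, b₋], c⟩` are thereby iterated derivatives, and
`⟨[a₊, b₊], c₊⟩ + ⟨[a₋, b₋], c₋⟩ = ⟨[a₊, b], c₊⟩ + ⟨[a, b₋], c₋⟩ - ⟨[a₊, b₋], c⟩`
is the Jacobiator of `{·,·}`. The Poisson property follows since both forms vanish when the
eigenbundles are closed under the bracket. If `ρ J = K ρ`, then `ρ pr₋ ρ*` is the
projection of `ρ ρ* = 0` to the `-1`-eigenbundle of `K`, so `π = 0`.
-/

noncomputable section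

namespace CourantGeometry

/-! ### Smooth bundle maps and sections -/

section SmoothHom

variable {EB : Type*} [NormedAddCommGroup EB] [NormedSpace ℝ EB] {H : Type*} [TopologicalSpace H]
  {I : ModelWithCorners ℝ EB H} {B : Type*} [TopologicalSpace B] [ChartedSpace H B]
  {k : WithTop ℕ∞}
  {F₁ : Type*} [NormedAddCommGroup F₁] [NormedSpace ℝ F₁]
  {E₁ : B → Type*} [∀ x, AddCommGroup (E₁ x)] [∀ x, Module ℝ (E₁ x)]
  [∀ x, TopologicalSpace (E₁ x)] [TopologicalSpace (TotalSpace F₁ E₁)]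
  [FiberBundle F₁ E₁] [VectorBundle ℝ F₁ E₁]
  {F₂ : Type*} [NormedAddCommGroup F₂] [NormedSpace ℝ F₂]
  {E₂ : B → Type*} [∀ x, AddCommGroup (E₂ x)] [∀ x, Module ℝ (E₂ x)]
  [∀ x, TopologicalSpace (E₂ x)] [TopologicalSpace (TotalSpace F₂ E₂)]
  [∀ x, IsTopologicalAddGroup (E₂ x)] [∀ x, ContinuousSMul ℝ (E₂ x)]
  [FiberBundle F₂ E₂] [VectorBundle ℝ F₂ E₂]

theorem contMDiffAt_clm_of_apply [FiniteDimensional ℝ F₁] {φ : B → F₁ →L[ℝ] F₂} {x : B}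
    (h : ∀ v, ContMDiffAt I 𝓘(ℝ, F₂) k (fun y ↦ φ y v) x) :
    ContMDiffAt I 𝓘(ℝ, F₁ →L[ℝ] F₂) k φ x := by
  let b := Module.finBasis ℝ F₁
  have hφ : φ = fun y ↦ ∑ i, ContinuousLinearMap.smulRightL ℝ F₁ F₂
      (LinearMap.toContinuousLinearMap (b.coord i)) (φ y (b i)) := by
    ext y v
    conv_lhs => rw [← b.sum_repr v, map_sum]
    simp
  rw [hφ]
  refine ContMDiffAt.sum fun i _ ↦ ?_
  exact (ContinuousLinearMap.contMDiff _).contMDiffAt.comp x (h (b i))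

/-- A bundle map which sends smooth sections to smooth sections is smooth. -/
theorem contMDiffAt_hom_of_apply [FiniteDimensional ℝ F₁] [ContMDiffVectorBundle k F₁ E₁ I]
    {φ : ∀ x, E₁ x →L[ℝ] E₂ x} {x : B}
    (h : ∀ s : ∀ y, E₁ y, ContMDiffAt I (I.prod 𝓘(ℝ, F₁)) k (fun y ↦ TotalSpace.mk' F₁ y (s y)) x →
      ContMDiffAt I (I.prod 𝓘(ℝ, F₂)) k (fun y ↦ TotalSpace.mk' F₂ y (φ y (s y))) x) :
    ContMDiffAt I (I.prod 𝓘(ℝ, F₁ →L[ℝ] F₂)) k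
      (fun y ↦ TotalSpace.mk' (F₁ →L[ℝ] F₂) (E := fun y ↦ E₁ y →L[ℝ] E₂ y) y (φ y)) x := by
  rw [contMDiffAt_hom_bundle]
  -- In coordinates, applying `φ` to a vector `v` of the model fibre is applying it to the section
  -- which is constant equal to `v` in the trivialization.
  refine ⟨contMDiffAt_id, contMDiffAt_clm_of_apply fun v ↦ ?_⟩
  let t := trivializationAt F₁ E₁ x
  have hx : x ∈ t.baseSet := FiberBundle.mem_baseSet_trivializationAt F₁ E₁ x
  have hs := h (FiberBundle.extend F₁ (t.symm x v)) (FiberBundle.contMDiffAt_extend I F₁ _)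
  rw [contMDiffAt_section] at hs
  refine hs.congr_of_eventuallyEq ?_
  filter_upwards [t.open_baseSet.mem_nhds hx, (trivializationAt F₂ E₂ x).open_baseSet.mem_nhds
    (FiberBundle.mem_baseSet_trivializationAt F₂ E₂ x)] with y hy hy'
  rw [ContinuousLinearMap.inCoordinates_eq hy hy']
  simp [FiberBundle.extend, t, hx]

/-- The inverse of a smooth bijective bundle map sends smooth sections to smooth sections. -/
theorem contMDiffAt_of_hom_apply [FiniteDimensional ℝ F₁] [FiniteDimensional ℝ F₂]
    {φ : ∀ x, E₁ x →L[ℝ] E₂ x} {s : ∀ x, E₁ x} {x : B}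
    (hφ : ContMDiffAt I (I.prod 𝓘(ℝ, F₁ →L[ℝ] F₂)) k
      (fun y ↦ TotalSpace.mk' (F₁ →L[ℝ] F₂) (E := fun y ↦ E₁ y →L[ℝ] E₂ y) y (φ y)) x)
    (hbij : ∀ y, Function.Bijective (φ y))
    (hs : ContMDiffAt I (I.prod 𝓘(ℝ, F₂)) k (fun y ↦ TotalSpace.mk' F₂ y (φ y (s y))) x) :
    ContMDiffAt I (I.prod 𝓘(ℝ, F₁)) k (fun y ↦ TotalSpace.mk' F₁ y (s y)) x := by
  rw [contMDiffAt_hom_bundle] at hφ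
  rw [contMDiffAt_section] at hs ⊢
  have hcomplete : CompleteSpace F₁ := FiniteDimensional.complete ℝ F₁
  have hcomplete' : CompleteSpace F₂ := FiniteDimensional.complete ℝ F₂
  set Φ := fun y ↦ ContinuousLinearMap.inCoordinates F₁ E₁ F₂ E₂ x y x y (φ y) with hΦ
  let t₁ := trivializationAt F₁ E₁ x
  let t₂ := trivializationAt F₂ E₂ x
  have hx₁ : x ∈ t₁.baseSet := FiberBundle.mem_baseSet_trivializationAt F₁ E₁ x
  have hx₂ : x ∈ t₂.baseSet := FiberBundle.mem_baseSet_trivializationAt F₂ E₂ x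
  have hinv : ∀ y ∈ t₁.baseSet, y ∈ t₂.baseSet → (Φ y).IsInvertible := fun y hy hy' ↦ by
    have hb : Function.Bijective (Φ y) := by
      rw [hΦ]
      simp only [ContinuousLinearMap.inCoordinates_eq hy hy', ContinuousLinearMap.coe_comp]
      exact (ContinuousLinearEquiv.bijective _).comp
        ((hbij y).comp (ContinuousLinearEquiv.bijective _))
    exact ⟨ContinuousLinearEquiv.ofBijective (Φ y) (LinearMap.ker_eq_bot.2 hb.1)
      (LinearMap.range_eq_top.2 hb.2), ContinuousLinearEquiv.coe_ofBijective _ _ _⟩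
  have hΦinv : ContMDiffAt I 𝓘(ℝ, F₂ →L[ℝ] F₁) k (fun y ↦ (Φ y).inverse) x :=
    (ContinuousLinearMap.IsInvertible.contDiffAt_map_inverse
      (hinv x hx₁ hx₂)).contMDiffAt.comp x hφ.2
  refine (hΦinv.clm_apply hs).congr_of_eventuallyEq ?_
  filter_upwards [t₁.open_baseSet.mem_nhds hx₁, t₂.open_baseSet.mem_nhds hx₂] with y hy hy'
  have : (t₂ ⟨y, φ y (s y)⟩).2 = Φ y (t₁ ⟨y, s y⟩).2 := by
    rw [hΦ]
    simp only [ContinuousLinearMap.inCoordinates_eq hy hy']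
    simp [t₁, t₂, hy]
  change (t₁ ⟨y, s y⟩).2 = (Φ y).inverse (t₂ ⟨y, φ y (s y)⟩).2
  rw [this]
  obtain ⟨e, he⟩ := hinv y hy hy'
  rw [← he]
  simp

end SmoothHom

section Sections

variable {EB : Type*} [NormedAddCommGroup EB] [NormedSpace ℝ EB] [FiniteDimensional ℝ EB]
  {H : Type*} [TopologicalSpace H]
  {I : ModelWithCorners ℝ EB H} {B : Type*} [TopologicalSpace B] [ChartedSpace H B]
  [IsManifold I ∞ B] [T2Space B]
  {F : Type*} [NormedAddCommGroup F] [NormedSpace ℝ F]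
  {E : B → Type*} [∀ x, AddCommGroup (E x)] [∀ x, Module ℝ (E x)]
  [∀ x, TopologicalSpace (E x)] [TopologicalSpace (TotalSpace F E)]
  [FiberBundle F E] [VectorBundle ℝ F E] [ContMDiffVectorBundle ∞ F E I]

variable (I) in
theorem exists_bump_of_mem_nhds {x : B} {u : Set B} (hu : u ∈ 𝓝 x) :
    ∃ χ : C^∞⟮I, B; ℝ⟯, χ x = 1 ∧ tsupport χ ⊆ u := by
  obtain ⟨χ, -, hχ⟩ := (SmoothBumpFunction.nhds_basis_tsupport (I := I) x).mem_iff.1 hu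
  exact ⟨⟨χ, χ.contMDiff⟩, χ.eq_one, hχ⟩

variable (I F) in
/-- Every vector in a fibre is the value of a global smooth section: a local extension is cut off by
a bump function. -/
theorem exists_section_eq {x : B} (v : E x) : ∃ s : Cₛ^∞⟮I; F, E⟯, s x = v := by
  obtain ⟨u, hu, hv⟩ := FiberBundle.exists_contMDiffOn_extend (k := ∞) I F v
  obtain ⟨o, ho, hoo, hxo⟩ := mem_nhds_iff.1 hu
  obtain ⟨χ, hχ, hχu⟩ := exists_bump_of_mem_nhds I (hoo.mem_nhds hxo)
  refine ⟨⟨fun y ↦ χ y • FiberBundle.extend F v y, ContMDiffOn.smul_section_of_tsupport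
    χ.contMDiff.contMDiffOn hoo hχu (hv.mono ho)⟩, ?_⟩
  change χ x • FiberBundle.extend F v x = v
  simp [hχ]

/-- A linear operation on smooth sections which at `x` is linear over smooth functions
depends only on the value of the section at `x`. -/
theorem eq_zero_of_section_eq_zero [FiniteDimensional ℝ F] {A : Type*} [AddCommGroup A] [Module ℝ A]
    (Φ : Cₛ^∞⟮I; F, E⟯ →ₗ[ℝ] A) (x : B)
    (hΦ : ∀ (f : C^∞⟮I, B; ℝ⟯) (s t : Cₛ^∞⟮I; F, E⟯), (∀ y, t y = f y • s y) → Φ t = f x • Φ s)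
    (s : Cₛ^∞⟮I; F, E⟯) (hs : s x = 0) : Φ s = 0 := by
  -- In a local frame, `χ² s = ∑ i, (χ cᵢ) (χ eᵢ)` holds globally for a bump function `χ`, and the
  -- coefficients `cᵢ` vanish at `x`.
  let t := trivializationAt F E x
  have hx : x ∈ t.baseSet := FiberBundle.mem_baseSet_trivializationAt F E x
  obtain ⟨χ, hχ, hχu⟩ := exists_bump_of_mem_nhds I (t.open_baseSet.mem_nhds hx)
  let b := Module.finBasis ℝ F
  have : ContMDiffVectorBundle 1 F E I := ContMDiffVectorBundle.of_le (n := ∞) (by simp)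
  let e i : Cₛ^∞⟮I; F, E⟯ := ⟨fun y ↦ χ y • t.localFrame b i y,
    ContMDiffOn.smul_section_of_tsupport χ.contMDiff.contMDiffOn t.open_baseSet hχu
      (t.contMDiffOn_localFrame_baseSet (I := I) ∞ b i)⟩
  let c i : C^∞⟮I, B; ℝ⟯ := ⟨fun y ↦ χ y • t.localFrameCoeff I b i y (s y),
    contMDiff_of_tsupport fun y hy ↦ by
      have hyt : y ∈ t.baseSet := hχu (tsupport_smul_subset_left _ _ hy)
      exact χ.contMDiff.contMDiffAt.smul
        (contMDiffAt_localFrameCoeff (I := I) b hyt s.contMDiff.contMDiffAt i)⟩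
  have hc i : c i x = 0 := by simp [c, hs]
  let s' : Cₛ^∞⟮I; F, E⟯ := ⟨fun y ↦ (χ * χ) y • s y, (χ * χ).contMDiff.smul_section s.contMDiff⟩
  let ce i : Cₛ^∞⟮I; F, E⟯ := ⟨fun y ↦ c i y • e i y, (c i).contMDiff.smul_section (e i).contMDiff⟩
  have hsum : s' = ∑ i, ce i := by
    ext y
    have hsum_apply : (∑ i, ce i) y = ∑ i, ce i y := by
      change ContMDiffSection.coeAddHom I F ∞ E (∑ i, ce i) y = _
      rw [map_sum, Finset.sum_apply]
      rfl
    rw [hsum_apply]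
    change (χ y * χ y) • s y =
      ∑ i, (χ y • t.localFrameCoeff I b i y (s y)) • χ y • t.localFrame b i y
    by_cases hy : y ∈ t.baseSet
    · conv_lhs => rw [t.eq_sum_localFrameCoeff_smul (I := I) (s := s) (b := b) hy, Finset.smul_sum]
      refine Finset.sum_congr rfl fun i _ ↦ ?_
      rw [smul_smul, smul_smul, smul_eq_mul]
      congr 1
      ring
    · have : χ y = 0 := image_eq_zero_of_notMem_tsupport fun h ↦ hy (hχu h)
      simp [this]
  calc Φ s = (χ * χ) x • Φ s := by simp [hχ]
    _ = Φ s' := (hΦ (χ * χ) s s' fun _ ↦ rfl).symm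
    _ = ∑ i, Φ (ce i) := by rw [hsum, map_sum]
    _ = 0 := Finset.sum_eq_zero fun i _ ↦ by
      rw [hΦ (c i) (e i) (ce i) fun _ ↦ rfl, hc, zero_smul]

end Sections

/-! ### Vector fields acting on functions -/

section VectorFields

variable {n : ℕ} {M : Type*} [TopologicalSpace M] [ChartedSpace (EuclideanSpace ℝ (Fin n)) M]
  [IsManifold (𝓡 n) ∞ M]

theorem contMDiffAt_differential_apply {f : M → ℝ} (hf : ContMDiff (𝓡 n) 𝓘(ℝ, ℝ) ∞ f)
    {X : ∀ x : M, TangentSpace (𝓡 n) x} {x : M}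
    (hX : ContMDiffAt (𝓡 n) ((𝓡 n).prod 𝓘(ℝ, EuclideanSpace ℝ (Fin n))) ∞
      (fun y ↦ TotalSpace.mk' (EuclideanSpace ℝ (Fin n)) y (X y)) x) :
    ContMDiffAt (𝓡 n) 𝓘(ℝ, ℝ) ∞ (fun y ↦ differential n f y (X y)) x := by
  have h := ((hf.contMDiff_tangentMap (m := ∞) (by simp)).contMDiffAt).comp x hX
  exact (contMDiff_snd_tangentBundle_modelSpace ℝ 𝓘(ℝ, ℝ)).contMDiffAt.comp x h

/-- The derivative `X f` of a smooth function along a smooth vector field. -/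
def dirDeriv (X : Cₛ^∞⟮𝓡 n; EuclideanSpace ℝ (Fin n), (TangentSpace (𝓡 n) : M → Type _)⟯)
    (f : C^∞⟮𝓡 n, M; ℝ⟯) : C^∞⟮𝓡 n, M; ℝ⟯ where
  val x := differential n f x (X x)
  property _ := contMDiffAt_differential_apply f.contMDiff X.contMDiff.contMDiffAt

theorem dirDeriv_apply
    (X : Cₛ^∞⟮𝓡 n; EuclideanSpace ℝ (Fin n), (TangentSpace (𝓡 n) : M → Type _)⟯)
    (f : C^∞⟮𝓡 n, M; ℝ⟯) (x : M) : dirDeriv X f x = differential n f x (X x) := rfl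

theorem mlieBracket_smul_section
    (X Y : Cₛ^∞⟮𝓡 n; EuclideanSpace ℝ (Fin n), (TangentSpace (𝓡 n) : M → Type _)⟯)
    (f : C^∞⟮𝓡 n, M; ℝ⟯) (x : M) :
    mlieBracket (𝓡 n) X (funSMul f Y) x =
      dirDeriv X f x • Y x + f x • mlieBracket (𝓡 n) X Y x :=
  mlieBracket_smul_right (f.contMDiff.mdifferentiableAt (by simp)) Y.mdifferentiableAt

/-- The Lie bracket of two smooth vector fields, as a smooth vector field. -/
def lieSection
    (X Y : Cₛ^∞⟮𝓡 n; EuclideanSpace ℝ (Fin n), (TangentSpace (𝓡 n) : M → Type _)⟯) :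
    Cₛ^∞⟮𝓡 n; EuclideanSpace ℝ (Fin n), (TangentSpace (𝓡 n) : M → Type _)⟯ where
  toFun := mlieBracket (𝓡 n) X Y
  contMDiff_toFun x := by
    have : IsManifold (𝓡 n) (minSmoothness ℝ 3) M :=
      IsManifold.of_le (n := ∞) (by simpa using ENat.LEInfty.out)
    have : IsManifold (𝓡 n) (((⊤ : ℕ∞) : WithTop ℕ∞) + 1) M := IsManifold.of_le (n := ∞) (by simp)
    exact ContMDiffAt.mlieBracket_vectorField (n := ⊤) X.contMDiff.contMDiffAt
      Y.contMDiff.contMDiffAt (by simp)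

/-- The Lie bracket acts on functions as the commutator. This is read off, without coordinates, from
the coefficient of `Z` in the Jacobi identity for `X`, `Y` and `f Z`. -/
theorem differential_mlieBracket [T2Space M]
    (X Y : Cₛ^∞⟮𝓡 n; EuclideanSpace ℝ (Fin n), (TangentSpace (𝓡 n) : M → Type _)⟯)
    (f : C^∞⟮𝓡 n, M; ℝ⟯) (x : M) :
    differential n f x (mlieBracket (𝓡 n) X Y x) =
      dirDeriv X (dirDeriv Y f) x - dirDeriv Y (dirDeriv X f) x := by
  have : IsManifold (𝓡 n) (minSmoothness ℝ 3) M :=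
    IsManifold.of_le (n := ∞) (by simpa using ENat.LEInfty.out)
  have key (Z : Cₛ^∞⟮𝓡 n; EuclideanSpace ℝ (Fin n), (TangentSpace (𝓡 n) : M → Type _)⟯) :
      (dirDeriv X (dirDeriv Y f) x - dirDeriv Y (dirDeriv X f) x -
        differential n f x (mlieBracket (𝓡 n) X Y x)) • Z x = 0 := by
    have hexp (U : Cₛ^∞⟮𝓡 n; EuclideanSpace ℝ (Fin n), (TangentSpace (𝓡 n) : M → Type _)⟯) :
        mlieBracket (𝓡 n) U (funSMul f Z) = funSMul (dirDeriv U f) Z + funSMul f (lieSection U Z) :=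
      funext fun y ↦ mlieBracket_smul_section U Z f y
    have htwo (U V : Cₛ^∞⟮𝓡 n; EuclideanSpace ℝ (Fin n), (TangentSpace (𝓡 n) : M → Type _)⟯) :
        mlieBracket (𝓡 n) U (mlieBracket (𝓡 n) V (funSMul f Z)) x =
          dirDeriv U (dirDeriv V f) x • Z x + dirDeriv V f x • mlieBracket (𝓡 n) U Z x +
            (dirDeriv U f x • mlieBracket (𝓡 n) V Z x +
              f x • mlieBracket (𝓡 n) U (mlieBracket (𝓡 n) V Z) x) := by
      rw [hexp, mlieBracket_add_right (funSMul (dirDeriv V f) Z).mdifferentiableAt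
        (funSMul f (lieSection V Z)).mdifferentiableAt]
      exact congrArg₂ (· + ·) (mlieBracket_smul_section U Z (dirDeriv V f) x)
        (mlieBracket_smul_section U (lieSection V Z) f x)
    have htwo_le : minSmoothness ℝ 2 ≤ (∞ : WithTop ℕ∞) := by
      simpa using ENat.LEInfty.out
    have hjac (W : Cₛ^∞⟮𝓡 n; EuclideanSpace ℝ (Fin n), (TangentSpace (𝓡 n) : M → Type _)⟯) :=
      leibniz_identity_mlieBracket_apply (I := 𝓡 n) (x := x)
        (X.contMDiff.contMDiffAt.of_le htwo_le) (Y.contMDiff.contMDiffAt.of_le htwo_le)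
        (W.contMDiff.contMDiffAt.of_le htwo_le)
    have h1 := hjac (funSMul f Z)
    have h2 : mlieBracket (𝓡 n) (mlieBracket (𝓡 n) X Y) (funSMul f Z) x =
        differential n f x (mlieBracket (𝓡 n) X Y x) • Z x +
          f x • mlieBracket (𝓡 n) (mlieBracket (𝓡 n) X Y) Z x :=
      mlieBracket_smul_section (lieSection X Y) Z f x
    rw [htwo, htwo, h2, hjac Z] at h1
    rw [sub_smul, sub_smul, sub_sub, sub_eq_zero]
    generalize mlieBracket (𝓡 n) X Z x = a at *
    generalize mlieBracket (𝓡 n) Y Z x = b at *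
    generalize mlieBracket (𝓡 n) (mlieBracket (𝓡 n) X Y) Z x = c at *
    generalize mlieBracket (𝓡 n) Y (mlieBracket (𝓡 n) X Z) x = d at *
    rw [smul_add] at h1
    have h3 := sub_eq_zero.2 h1
    rw [← sub_eq_zero, ← h3]
    abel
  by_cases hx : ∃ v : TangentSpace (𝓡 n) x, v ≠ 0
  · obtain ⟨v, hv⟩ := hx
    obtain ⟨Z, hZ⟩ := exists_section_eq (𝓡 n) (EuclideanSpace ℝ (Fin n)) v
    have := (smul_eq_zero.1 (key Z)).resolve_right (hZ ▸ hv)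
    linarith
  -- On a zero-dimensional manifold all terms vanish.
  · push Not at hx
    rw [dirDeriv_apply, dirDeriv_apply, hx (X x), hx (Y x), hx (mlieBracket _ _ _ _)]
    simp

end VectorFields

/-! ### Smoothness of the coanchor, and the bracket with gradients -/

section MetricSmoothness

variable {M : Type*} {n : ℕ}
  [TopologicalSpace M] [ChartedSpace (EuclideanSpace ℝ (Fin n)) M]
  {F : Type*} [NormedAddCommGroup F] [NormedSpace ℝ F]
  {E : M → Type*} [∀ x, AddCommGroup (E x)] [∀ x, Module ℝ (E x)]
  [∀ x, TopologicalSpace (E x)] [TopologicalSpace (TotalSpace F E)]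
  [∀ x, IsTopologicalAddGroup (E x)] [∀ x, ContinuousSMul ℝ (E x)]
  [FiberBundle F E] [VectorBundle ℝ F E]

namespace BundleMetric

/-- By non-degeneracy, a section is smooth if its pairings with smooth sections are. -/
theorem contMDiffAt_of_inner [FiniteDimensional ℝ F] [ContMDiffVectorBundle ∞ F E (𝓡 n)]
    (g : BundleMetric n F E) {s : ∀ x, E x} {x : M}
    (h : ∀ t : ∀ x, E x,
      ContMDiffAt (𝓡 n) ((𝓡 n).prod 𝓘(ℝ, F)) ∞ (fun y ↦ TotalSpace.mk' F y (t y)) x →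
      ContMDiffAt (𝓡 n) 𝓘(ℝ, ℝ) ∞ (fun y ↦ g.inner y (s y) (t y)) x) :
    ContMDiffAt (𝓡 n) ((𝓡 n).prod 𝓘(ℝ, F)) ∞ (fun y ↦ TotalSpace.mk' F y (s y)) x := by
  refine contMDiffAt_of_hom_apply (E₂ := fun y ↦ E y →L[ℝ] Bundle.Trivial M ℝ y) (φ := g.inner)
    g.contMDiff.contMDiffAt (fun y ↦ g.inner_bijective y) ?_
  refine contMDiffAt_hom_of_apply (E₂ := Bundle.Trivial M ℝ) fun t ht ↦ ?_
  exact contMDiffAt_totalSpace.2 ⟨contMDiffAt_id, h t ht⟩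

end BundleMetric

end MetricSmoothness

section Courant

variable {M : Type*} {n : ℕ}
  [TopologicalSpace M] [ChartedSpace (EuclideanSpace ℝ (Fin n)) M] [IsManifold (𝓡 n) ∞ M]
  {F : Type*} [NormedAddCommGroup F] [NormedSpace ℝ F] [FiniteDimensional ℝ F]
  {E : M → Type*} [∀ x, AddCommGroup (E x)] [∀ x, Module ℝ (E x)]
  [∀ x, TopologicalSpace (E x)] [TopologicalSpace (TotalSpace F E)]
  [∀ x, IsTopologicalAddGroup (E x)] [∀ x, ContinuousSMul ℝ (E x)]
  [FiberBundle F E] [VectorBundle ℝ F E] [ContMDiffVectorBundle ∞ F E (𝓡 n)]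

namespace CourantAlgebroid

theorem inner_coanchor (A : CourantAlgebroid n F E) (x : M)
    (μ : TangentSpace (𝓡 n) x →L[ℝ] ℝ) (e : E x) :
    A.inner x (A.coanchor x μ) e = μ (A.anchor x e) :=
  A.toBundleMetric.inner_dualMap x (A.anchor x) μ e

theorem inner_coanchor_right (A : CourantAlgebroid n F E) (x : M)
    (μ : TangentSpace (𝓡 n) x →L[ℝ] ℝ) (e : E x) :
    A.inner x e (A.coanchor x μ) = μ (A.anchor x e) := by
  rw [A.symm, inner_coanchor]

theorem contMDiffAt_anchor (A : CourantAlgebroid n F E) {s : ∀ x, E x} {x : M}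
    (hs : ContMDiffAt (𝓡 n) ((𝓡 n).prod 𝓘(ℝ, F)) ∞ (fun y ↦ TotalSpace.mk' F y (s y)) x) :
    ContMDiffAt (𝓡 n) ((𝓡 n).prod 𝓘(ℝ, EuclideanSpace ℝ (Fin n))) ∞
      (fun y ↦ TotalSpace.mk' (EuclideanSpace ℝ (Fin n)) y (A.anchor y (s y))) x :=
  A.contMDiff_anchor.contMDiffAt.clm_bundle_apply hs

theorem contMDiffAt_coanchor (A : CourantAlgebroid n F E)
    {μ : ∀ x : M, TangentSpace (𝓡 n) x →L[ℝ] ℝ} {x : M}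
    (hμ : ∀ X : ∀ x : M, TangentSpace (𝓡 n) x,
      ContMDiffAt (𝓡 n) ((𝓡 n).prod 𝓘(ℝ, EuclideanSpace ℝ (Fin n))) ∞
        (fun y ↦ TotalSpace.mk' (EuclideanSpace ℝ (Fin n)) y (X y)) x →
      ContMDiffAt (𝓡 n) 𝓘(ℝ, ℝ) ∞ (fun y ↦ μ y (X y)) x) :
    ContMDiffAt (𝓡 n) ((𝓡 n).prod 𝓘(ℝ, F)) ∞
      (fun y ↦ TotalSpace.mk' F y (A.coanchor y (μ y))) x := by
  refine A.toBundleMetric.contMDiffAt_of_inner fun t ht ↦ ?_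
  simp only [inner_coanchor]
  exact hμ _ (A.contMDiffAt_anchor ht)

/-- The vector field `ρ(a)`. -/
def anchorSection (A : CourantAlgebroid n F E) (a : Cₛ^∞⟮𝓡 n; F, E⟯) :
    Cₛ^∞⟮𝓡 n; EuclideanSpace ℝ (Fin n), (TangentSpace (𝓡 n) : M → Type _)⟯ where
  toFun x := A.anchor x (a x)
  contMDiff_toFun _ := A.contMDiffAt_anchor a.contMDiff.contMDiffAt

/-- The derivative `ρ(a) f`. -/
def act (A : CourantAlgebroid n F E) (a : Cₛ^∞⟮𝓡 n; F, E⟯) (f : C^∞⟮𝓡 n, M; ℝ⟯) :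
    C^∞⟮𝓡 n, M; ℝ⟯ :=
  dirDeriv (A.anchorSection a) f

theorem act_apply (A : CourantAlgebroid n F E) (a : Cₛ^∞⟮𝓡 n; F, E⟯) (f : C^∞⟮𝓡 n, M; ℝ⟯)
    (x : M) : A.act a f x = differential n f x (A.anchor x (a x)) := rfl

/-- The section `ρ* df`. -/
def grad (A : CourantAlgebroid n F E) (f : C^∞⟮𝓡 n, M; ℝ⟯) : Cₛ^∞⟮𝓡 n; F, E⟯ where
  toFun x := A.coanchor x (differential n f x)
  contMDiff_toFun _ :=
    A.contMDiffAt_coanchor fun _ hX ↦ contMDiffAt_differential_apply f.contMDiff hX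

theorem inner_grad (A : CourantAlgebroid n F E) (f : C^∞⟮𝓡 n, M; ℝ⟯) (a : Cₛ^∞⟮𝓡 n; F, E⟯)
    (x : M) : A.inner x (a x) (A.grad f x) = A.act a f x :=
  A.inner_coanchor_right x _ _

theorem act_bracket [T2Space M] (A : CourantAlgebroid n F E) (a b : Cₛ^∞⟮𝓡 n; F, E⟯)
    (f : C^∞⟮𝓡 n, M; ℝ⟯) (x : M) :
    A.act (A.bracket a b) f x = A.act a (A.act b f) x - A.act b (A.act a f) x := by
  rw [act_apply, A.anchor_bracket]
  exact differential_mlieBracket (A.anchorSection a) (A.anchorSection b) f x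

/-- `⟨[a, ρ* df], c⟩ = ρ(c)(ρ(a) f) / 2`: in the invariance of the metric, `ρ ρ* df = 0` removes one
term, and the others are derivatives of `f`. -/
theorem inner_bracket_grad [T2Space M] (A : CourantAlgebroid n F E) (a c : Cₛ^∞⟮𝓡 n; F, E⟯)
    (f : C^∞⟮𝓡 n, M; ℝ⟯) (x : M) :
    A.inner x (A.bracket a (A.grad f) x) (c x) = (1 / 2 : ℝ) * A.act c (A.act a f) x := by
  have h := A.metric_invariant a (A.grad f) c x
  have h1 : (fun y ↦ A.inner y (A.grad f y) (c y)) = A.act c f := by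
    ext y; rw [A.symm, inner_grad]
  have h2 : (fun y ↦ A.inner y (a y) (A.grad f y)) = A.act a f := by
    ext y; rw [inner_grad]
  have h3 : A.inner x (A.grad f x) (A.bracket a c x) =
      A.act a (A.act c f) x - A.act c (A.act a f) x := by
    rw [A.symm, inner_grad, act_bracket]
  have h4 : A.anchor x (A.grad f x) = 0 := A.anchor_dual f x
  rw [h1, h2, h3, h4, map_zero, ← act_apply, ← act_apply] at h
  linarith

theorem inner_grad_bracket [T2Space M] (A : CourantAlgebroid n F E) (a c : Cₛ^∞⟮𝓡 n; F, E⟯)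
    (f : C^∞⟮𝓡 n, M; ℝ⟯) (x : M) :
    A.inner x (A.bracket (A.grad f) a x) (c x) = -((1 / 2 : ℝ) * A.act c (A.act a f) x) := by
  rw [A.bracket_skew, ← inner_bracket_grad]
  simp

/-- For arbitrary decompositions of three gradients, `⟨[a, b], c⟩ + ⟨[a', b'], c'⟩` is a combination
of iterated derivatives. -/
theorem inner_bracket_add_inner_bracket [T2Space M] (A : CourantAlgebroid n F E)
    (f h k : C^∞⟮𝓡 n, M; ℝ⟯) {a a' b b' c c' : Cₛ^∞⟮𝓡 n; F, E⟯}
    (ha : a + a' = A.grad f) (hb : b + b' = A.grad h) (hc : c + c' = A.grad k) (x : M) :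
    A.inner x (A.bracket a b x) (c x) + A.inner x (A.bracket a' b' x) (c' x) =
      (1 / 2 : ℝ) * A.act c (A.act a h) x - (1 / 2 : ℝ) * A.act c' (A.act b' f) x -
        (A.act a (A.act b' k) x - A.act b' (A.act a k) x) := by
  -- The pairings `⟨[a, D h], c⟩`, `⟨[D f, b'], c'⟩` and `⟨[a, b'], D k⟩`: adding the first two and
  -- subtracting the third cancels the mixed terms `⟨[a, b'], c⟩` and `⟨[a, b'], c'⟩`.
  have h1 := A.inner_bracket_grad a c h x
  have h2 := A.inner_grad_bracket b' c' f x
  have h3 := A.inner_grad k (A.bracket a b') x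
  rw [A.act_bracket, ← hc] at h3
  rw [← hb] at h1
  rw [← ha] at h2
  simp only [map_add, LinearMap.add_apply, ContMDiffSection.coe_add, Pi.add_apply,
    add_apply] at h1 h2 h3
  linarith

end CourantAlgebroid

end Courant

/-! ### Eigenbundle projections and the obstruction forms -/

section ParaComplex

variable {M : Type*} {n : ℕ}
  [TopologicalSpace M] [ChartedSpace (EuclideanSpace ℝ (Fin n)) M]
  {F : Type*} [NormedAddCommGroup F] [NormedSpace ℝ F]
  {E : M → Type*} [∀ x, AddCommGroup (E x)] [∀ x, Module ℝ (E x)]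
  [∀ x, TopologicalSpace (E x)] [TopologicalSpace (TotalSpace F E)]
  [∀ x, IsTopologicalAddGroup (E x)] [∀ x, ContinuousSMul ℝ (E x)]
  [FiberBundle F E] [VectorBundle ℝ F E]

namespace ParaComplexStructure

theorem prPlus_apply (J : ParaComplexStructure n F E) (x : M) (v : E x) :
    J.prPlus x v = (1 / 2 : ℝ) • (v + J.toFun x v) := rfl

theorem prMinus_apply (J : ParaComplexStructure n F E) (x : M) (v : E x) :
    J.prMinus x v = (1 / 2 : ℝ) • (v - J.toFun x v) := rfl

theorem prPlus_add_prMinus (J : ParaComplexStructure n F E) (x : M) (v : E x) :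
    J.prPlus x v + J.prMinus x v = v := by
  rw [prPlus_apply, prMinus_apply]
  module

theorem apply_prPlus (J : ParaComplexStructure n F E) (x : M) (v : E x) :
    J.toFun x (J.prPlus x v) = J.prPlus x v := by
  rw [prPlus_apply, map_smul, map_add, J.sq_eq_id, add_comm]

theorem prPlus_of_eq (J : ParaComplexStructure n F E) (x : M) {v : E x}
    (h : J.toFun x v = v) : J.prPlus x v = v := by
  rw [prPlus_apply, h]
  module

theorem prPlus_of_eq_neg (J : ParaComplexStructure n F E) (x : M) {v : E x}
    (h : J.toFun x v = -v) : J.prPlus x v = 0 := by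
  rw [prPlus_apply, h]
  module

theorem prMinus_of_eq_neg (J : ParaComplexStructure n F E) (x : M) {v : E x}
    (h : J.toFun x v = -v) : J.prMinus x v = v := by
  rw [prMinus_apply, h]
  module

theorem apply_prMinus (J : ParaComplexStructure n F E) (x : M) (v : E x) :
    J.toFun x (J.prMinus x v) = -J.prMinus x v := by
  rw [prMinus_apply, map_smul, map_sub, J.sq_eq_id]
  module

theorem contMDiffAt_apply (J : ParaComplexStructure n F E) {s : ∀ x, E x} {x : M}
    (hs : ContMDiffAt (𝓡 n) ((𝓡 n).prod 𝓘(ℝ, F)) ∞ (fun y ↦ TotalSpace.mk' F y (s y)) x) :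
    ContMDiffAt (𝓡 n) ((𝓡 n).prod 𝓘(ℝ, F)) ∞
      (fun y ↦ TotalSpace.mk' F y (J.toFun y (s y))) x :=
  J.contMDiff.contMDiffAt.clm_bundle_apply hs

theorem contMDiffAt_prMinus (J : ParaComplexStructure n F E) {s : ∀ x, E x} {x : M}
    (hs : ContMDiffAt (𝓡 n) ((𝓡 n).prod 𝓘(ℝ, F)) ∞ (fun y ↦ TotalSpace.mk' F y (s y)) x) :
    ContMDiffAt (𝓡 n) ((𝓡 n).prod 𝓘(ℝ, F)) ∞
      (fun y ↦ TotalSpace.mk' F y (J.prMinus y (s y))) x :=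
  (hs.sub_section (J.contMDiffAt_apply hs)).const_smul_section (a := (1 / 2 : ℝ))

/-- The structure `-J`, which exchanges the two eigenbundles. -/
def neg [ContMDiffVectorBundle ∞ F E (𝓡 n)] (J : ParaComplexStructure n F E) :
    ParaComplexStructure n F E where
  toFun x := -J.toFun x
  sq_eq_id x v := by simp [J.sq_eq_id]
  finrank_eq x := by
    have h (c : ℝ) : Module.End.eigenspace ((-J.toFun x : E x →L[ℝ] E x) : E x →ₗ[ℝ] E x) c =
        Module.End.eigenspace (J.toFun x : E x →ₗ[ℝ] E x) (-c) := by
      ext v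
      simp [neg_eq_iff_eq_neg]
    rw [h, h, neg_neg, J.finrank_eq]
  contMDiff := J.contMDiff.neg_section

theorem prMinus_neg [ContMDiffVectorBundle ∞ F E (𝓡 n)] (J : ParaComplexStructure n F E) (x : M) :
    J.neg.prMinus x = J.prPlus x := by
  simp [prMinus, prPlus, neg]

theorem prPlus_neg [ContMDiffVectorBundle ∞ F E (𝓡 n)] (J : ParaComplexStructure n F E) (x : M) :
    J.neg.prPlus x = J.prMinus x := by
  simp [prMinus, prPlus, neg, sub_eq_add_neg]

variable [ContMDiffVectorBundle ∞ F E (𝓡 n)]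

/-- The projection of sections of `E` to sections of the `-1`-eigenbundle. -/
def minusPart (J : ParaComplexStructure n F E) : Cₛ^∞⟮𝓡 n; F, E⟯ →ₗ[ℝ] Cₛ^∞⟮𝓡 n; F, E⟯ where
  toFun s := ⟨fun x ↦ J.prMinus x (s x), fun _ ↦ J.contMDiffAt_prMinus s.contMDiff.contMDiffAt⟩
  map_add' s t := by ext x; exact map_add (J.prMinus x) (s x) (t x)
  map_smul' c s := by ext x; exact map_smul (J.prMinus x) c (s x)

/-- The projection of sections of `E` to sections of the `+1`-eigenbundle. -/
def plusPart (J : ParaComplexStructure n F E) : Cₛ^∞⟮𝓡 n; F, E⟯ →ₗ[ℝ] Cₛ^∞⟮𝓡 n; F, E⟯ :=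
  LinearMap.id - J.minusPart

theorem minusPart_apply (J : ParaComplexStructure n F E) (s : Cₛ^∞⟮𝓡 n; F, E⟯) (x : M) :
    J.minusPart s x = J.prMinus x (s x) := rfl

theorem plusPart_apply (J : ParaComplexStructure n F E) (s : Cₛ^∞⟮𝓡 n; F, E⟯) (x : M) :
    J.plusPart s x = J.prPlus x (s x) :=
  sub_eq_of_eq_add (J.prPlus_add_prMinus x (s x)).symm

theorem plusPart_add_minusPart (J : ParaComplexStructure n F E) (s : Cₛ^∞⟮𝓡 n; F, E⟯) :
    J.plusPart s + J.minusPart s = s :=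
  sub_add_cancel s (J.minusPart s)

theorem plusPart_neg (J : ParaComplexStructure n F E) : J.neg.plusPart = J.minusPart := by
  ext s x
  rw [plusPart_apply, minusPart_apply, prPlus_neg]

theorem isPlus_plusPart (J : ParaComplexStructure n F E) (s : Cₛ^∞⟮𝓡 n; F, E⟯) :
    J.IsPlus (J.plusPart s) := fun x ↦ by
  rw [plusPart_apply, apply_prPlus]

theorem plusPart_of_isPlus (J : ParaComplexStructure n F E) {s : Cₛ^∞⟮𝓡 n; F, E⟯}
    (h : J.IsPlus s) : J.plusPart s = s := by
  ext x
  rw [plusPart_apply, J.prPlus_of_eq x (h x)]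

theorem plusPart_minusPart (J : ParaComplexStructure n F E) (s : Cₛ^∞⟮𝓡 n; F, E⟯) :
    J.plusPart (J.minusPart s) = 0 := by
  ext x
  rw [plusPart_apply, minusPart_apply, J.prPlus_of_eq_neg x (J.apply_prMinus x _)]
  rfl

end ParaComplexStructure

namespace AlmostParaHermitianStructure

variable {g : BundleMetric n F E}

/-- The eigenbundle `E₊` is isotropic. -/
theorem inner_eq_zero_of_plus (J : AlmostParaHermitianStructure g) {x : M} {v w : E x}
    (hv : J.toFun x v = v) (hw : J.toFun x w = w) : g.inner x v w = 0 := by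
  have := J.compatible x v w
  rw [hv, hw] at this
  linarith

theorem inner_prMinus_of_plus (J : AlmostParaHermitianStructure g) {x : M} (v : E x) {w : E x}
    (hw : J.toFun x w = w) : g.inner x (J.prMinus x v) w = g.inner x v w := by
  have := J.inner_eq_zero_of_plus (J.apply_prPlus x v) hw
  conv_rhs => rw [← J.prPlus_add_prMinus x v, map_add, add_apply, this, zero_add]

theorem inner_apply_right (J : AlmostParaHermitianStructure g) (x : M) (v w : E x) :
    g.inner x v (J.toFun x w) = -g.inner x w (J.toFun x v) := by
  have := J.compatible x v (J.toFun x w)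
  rw [J.sq_eq_id] at this
  rw [g.symm x w, this, neg_neg]

/-- The structure `-J`, which exchanges the two eigenbundles. -/
def neg [ContMDiffVectorBundle ∞ F E (𝓡 n)] (J : AlmostParaHermitianStructure g) :
    AlmostParaHermitianStructure g where
  toParaComplexStructure := J.toParaComplexStructure.neg
  compatible x v w := by simp [ParaComplexStructure.neg, J.compatible]

end AlmostParaHermitianStructure

end ParaComplex

section Courant

variable {M : Type*} {n : ℕ}
  [TopologicalSpace M] [ChartedSpace (EuclideanSpace ℝ (Fin n)) M] [IsManifold (𝓡 n) ∞ M]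
  {F : Type*} [NormedAddCommGroup F] [NormedSpace ℝ F] [FiniteDimensional ℝ F]
  {E : M → Type*} [∀ x, AddCommGroup (E x)] [∀ x, Module ℝ (E x)]
  [∀ x, TopologicalSpace (E x)] [TopologicalSpace (TotalSpace F E)]
  [∀ x, IsTopologicalAddGroup (E x)] [∀ x, ContinuousSMul ℝ (E x)]
  [FiberBundle F E] [VectorBundle ℝ F E] [ContMDiffVectorBundle ∞ F E (𝓡 n)]

namespace CourantAlgebroid

section Obstruction

variable (A : CourantAlgebroid n F E) (J : AlmostParaHermitianStructure A.toBundleMetric)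

/-- The function `⟨[a₊, b₊], c₊⟩` at `x`. -/
def plusForm (a b c : Cₛ^∞⟮𝓡 n; F, E⟯) (x : M) : ℝ :=
  A.inner x (A.bracket (J.plusPart a) (J.plusPart b) x) (J.plusPart c x)

theorem inner_plusPart (a b : Cₛ^∞⟮𝓡 n; F, E⟯) (x : M) :
    A.inner x (J.plusPart a x) (J.plusPart b x) = 0 :=
  J.inner_eq_zero_of_plus (J.isPlus_plusPart a x) (J.isPlus_plusPart b x)

theorem plusForm_swap (a b c : Cₛ^∞⟮𝓡 n; F, E⟯) (x : M) :
    A.plusForm J a b c x = -A.plusForm J b a c x := by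
  rw [plusForm, plusForm, A.bracket_skew]
  simp

theorem plusForm_swap_right (a b c : Cₛ^∞⟮𝓡 n; F, E⟯) (x : M) :
    A.plusForm J a b c x = -A.plusForm J a c b x := by
  have h := A.metric_invariant (J.plusPart a) (J.plusPart b) (J.plusPart c) x
  have hd : differential n (fun _ : M ↦ (0 : ℝ)) x = 0 := mfderiv_const
  simp only [inner_plusPart, hd, zero_apply, mul_zero, add_zero] at h
  rw [A.symm x (J.plusPart b x)] at h
  rw [plusForm, plusForm]
  linarith

/-- `⟨[a₊, b₊], c₊⟩` is linear over functions in `a`, so that its value at `x` depends only on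
`a x`. -/
theorem plusForm_eq_zero [T2Space M] {a : Cₛ^∞⟮𝓡 n; F, E⟯} {x : M} (ha : a x = 0)
    (b c : Cₛ^∞⟮𝓡 n; F, E⟯) : A.plusForm J a b c x = 0 := by
  let Φ : Cₛ^∞⟮𝓡 n; F, E⟯ →ₗ[ℝ] ℝ :=
    { toFun s := A.plusForm J s b c x
      map_add' s t := by simp [plusForm]
      map_smul' r s := by simp [plusForm] }
  refine eq_zero_of_section_eq_zero Φ x (fun f s t hst ↦ ?_) a ha
  have ht : J.plusPart t = funSMul f (J.plusPart s) := by
    ext y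
    rw [J.plusPart_apply, hst, map_smul, ← J.plusPart_apply]
    rfl
  change A.plusForm J t b c x = f x • A.plusForm J s b c x
  rw [plusForm_swap, plusForm_swap A J s, plusForm, plusForm, ht, A.leibniz]
  simp [inner_plusPart]

/-- `(a, b, c) ↦ ⟨[a₊, b₊], c₊⟩` at `x`, as an alternating map on sections. -/
def plusFormMap (x : M) : Cₛ^∞⟮𝓡 n; F, E⟯ [⋀^Fin 3]→ₗ[ℝ] ℝ where
  toFun m := A.plusForm J (m 0) (m 1) (m 2) x
  map_update_add' := by
    intro inst m i s t
    obtain rfl : inst = instDecidableEqFin 3 := Subsingleton.elim _ _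
    fin_cases i <;> simp [plusForm, Function.update]
  map_update_smul' := by
    intro inst m i r s
    obtain rfl : inst = instDecidableEqFin 3 := Subsingleton.elim _ _
    fin_cases i <;> simp [plusForm, Function.update]
  map_eq_zero_of_eq' m i j hm hij := by
    have h01 (a c) : A.plusForm J a a c x = 0 := by
      have := A.plusForm_swap J a a c x
      linarith
    have h12 (a b) : A.plusForm J a b b x = 0 := by
      have := A.plusForm_swap_right J a b b x
      linarith
    have h02 (a b) : A.plusForm J a b a x = 0 := by
      rw [plusForm_swap, h12, neg_zero]
    fin_cases i <;> fin_cases j <;> first | exact absurd rfl hij | skip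
    all_goals dsimp only [Fin.zero_eta, Fin.mk_one, Fin.reduceFinMk] at hm ⊢
    all_goals rw [hm]
    all_goals first | exact h01 _ _ | exact h12 _ _ | exact h02 _ _

/-- The operation `⟨[a₊, b₊], c₊⟩` on sections comes from alternating forms on the fibres. -/
theorem exists_plusForm [T2Space M] :
    ∃ φ : ∀ x, E x [⋀^Fin 3]→ₗ[ℝ] ℝ, ∀ (a b c : Cₛ^∞⟮𝓡 n; F, E⟯) (x : M),
      φ x ![a x, b x, c x] = A.plusForm J a b c x := by
  -- A linear choice of extensions of vectors at `x` to sections.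
  have hr (x : M) : ∃ r : E x →ₗ[ℝ] Cₛ^∞⟮𝓡 n; F, E⟯, ∀ v, r v x = v := by
    let ev : Cₛ^∞⟮𝓡 n; F, E⟯ →ₗ[ℝ] E x :=
      { toFun s := s x
        map_add' _ _ := rfl
        map_smul' _ _ := rfl }
    obtain ⟨r, hr⟩ := ev.exists_rightInverse_of_surjective
      (LinearMap.range_eq_top.2 fun v ↦ exists_section_eq (𝓡 n) F v)
    exact ⟨r, fun v ↦ LinearMap.congr_fun hr v⟩
  choose r hr using hr
  refine ⟨fun x ↦ (A.plusFormMap J x).compLinearMap (r x), fun a b c x ↦ ?_⟩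
  change A.plusForm J (r x (a x)) (r x (b x)) (r x (c x)) x = _
  have h0 (a a' b c : Cₛ^∞⟮𝓡 n; F, E⟯) (h : a x = a' x) :
      A.plusForm J a b c x = A.plusForm J a' b c x := by
    rw [← sub_eq_zero, ← A.plusForm_eq_zero J (a := a - a') (sub_eq_zero.2 h) b c]
    simp [plusForm]
  rw [h0 _ a _ _ (hr x _), plusForm_swap, h0 _ b _ _ (hr x _), ← plusForm_swap,
    plusForm_swap_right, plusForm_swap, h0 _ c _ _ (hr x _), ← plusForm_swap,
    ← plusForm_swap_right]

theorem exists_plusObstruction [T2Space M] :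
    ∃ φ : ∀ x, E x [⋀^Fin 3]→ₗ[ℝ] ℝ, A.IsPlusObstruction J φ ∧
      ∀ (a b c : Cₛ^∞⟮𝓡 n; F, E⟯) (x : M), φ x ![a x, b x, c x] = A.plusForm J a b c x := by
  obtain ⟨φ, hφ⟩ := A.exists_plusForm J
  refine ⟨φ, ⟨fun x u v w hu ↦ ?_, fun a b c ha hb hc x ↦ ?_⟩, hφ⟩
  · obtain ⟨a, rfl⟩ := exists_section_eq (𝓡 n) F u
    obtain ⟨b, rfl⟩ := exists_section_eq (𝓡 n) F v
    obtain ⟨c, rfl⟩ := exists_section_eq (𝓡 n) F w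
    -- The extension of `u` may be taken in `E₋`.
    have h := hφ (J.minusPart a) b c x
    rw [J.minusPart_apply, J.prMinus_of_eq_neg x hu] at h
    rw [h, plusForm, J.plusPart_minusPart]
    simp
  · rw [hφ, plusForm, J.plusPart_of_isPlus ha, J.plusPart_of_isPlus hb, J.plusPart_of_isPlus hc,
      J.inner_prMinus_of_plus _ (hc x)]

theorem IsPlusObstruction.of_neg {A : CourantAlgebroid n F E}
    {J : AlmostParaHermitianStructure A.toBundleMetric} {φ : ∀ x, E x [⋀^Fin 3]→ₗ[ℝ] ℝ}
    (h : A.IsPlusObstruction J.neg φ) : A.IsMinusObstruction J φ := by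
  have hneg {x : M} {v : E x} (hv : J.toFun x v = -v) : J.neg.toFun x v = v := by
    change -J.toFun x v = v
    rw [hv, neg_neg]
  refine ⟨fun x u v w hu ↦ h.1 x u v w ?_, fun a b c ha hb hc x ↦ ?_⟩
  · change -J.toFun x u = -u
    rw [hu]
  · rw [h.2 a b c (fun y ↦ hneg (ha y)) (fun y ↦ hneg (hb y)) (fun y ↦ hneg (hc y)) x]
    exact congrArg (fun p ↦ A.inner x (p (A.bracket a b x)) (c x)) (J.prMinus_neg x)

end Obstruction

end CourantAlgebroid

end Courant

/-! ### The bivector field -/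

section Courant

variable {M : Type*} {n : ℕ}
  [TopologicalSpace M] [ChartedSpace (EuclideanSpace ℝ (Fin n)) M] [IsManifold (𝓡 n) ∞ M]
  {F : Type*} [NormedAddCommGroup F] [NormedSpace ℝ F] [FiniteDimensional ℝ F]
  {E : M → Type*} [∀ x, AddCommGroup (E x)] [∀ x, Module ℝ (E x)]
  [∀ x, TopologicalSpace (E x)] [TopologicalSpace (TotalSpace F E)]
  [∀ x, IsTopologicalAddGroup (E x)] [∀ x, ContinuousSMul ℝ (E x)]
  [FiberBundle F E] [VectorBundle ℝ F E] [ContMDiffVectorBundle ∞ F E (𝓡 n)]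

set_option maxSynthPendingDepth 3 in
/-- A family of bilinear forms on the cotangent spaces is smooth if it sends smooth covector fields
to smooth functions. -/
theorem contMDiffAt_bivector
    {P : ∀ x : M, (TangentSpace (𝓡 n) x →L[ℝ] ℝ) →L[ℝ] (TangentSpace (𝓡 n) x →L[ℝ] ℝ) →L[ℝ] ℝ}
    {x : M}
    (h : ∀ μ ν : ∀ x : M, TangentSpace (𝓡 n) x →L[ℝ] ℝ,
      ContMDiffAt (𝓡 n) ((𝓡 n).prod 𝓘(ℝ, EuclideanSpace ℝ (Fin n) →L[ℝ] ℝ)) ∞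
        (fun y ↦ TotalSpace.mk' (EuclideanSpace ℝ (Fin n) →L[ℝ] ℝ)
          (E := fun y : M ↦ TangentSpace (𝓡 n) y →L[ℝ] ℝ) y (μ y)) x →
      ContMDiffAt (𝓡 n) ((𝓡 n).prod 𝓘(ℝ, EuclideanSpace ℝ (Fin n) →L[ℝ] ℝ)) ∞
        (fun y ↦ TotalSpace.mk' (EuclideanSpace ℝ (Fin n) →L[ℝ] ℝ)
          (E := fun y : M ↦ TangentSpace (𝓡 n) y →L[ℝ] ℝ) y (ν y)) x →
      ContMDiffAt (𝓡 n) 𝓘(ℝ, ℝ) ∞ (fun y ↦ P y (μ y) (ν y)) x) :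
    ContMDiffAt (𝓡 n)
      ((𝓡 n).prod 𝓘(ℝ, (EuclideanSpace ℝ (Fin n) →L[ℝ] ℝ) →L[ℝ]
        (EuclideanSpace ℝ (Fin n) →L[ℝ] ℝ) →L[ℝ] ℝ)) ∞
      (fun x ↦ TotalSpace.mk' ((EuclideanSpace ℝ (Fin n) →L[ℝ] ℝ) →L[ℝ]
        (EuclideanSpace ℝ (Fin n) →L[ℝ] ℝ) →L[ℝ] ℝ)
        (E := fun x : M ↦ (TangentSpace (𝓡 n) x →L[ℝ] ℝ) →L[ℝ]
          (TangentSpace (𝓡 n) x →L[ℝ] ℝ) →L[ℝ] ℝ) x (P x)) x := by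
  refine contMDiffAt_hom_of_apply (F₁ := EuclideanSpace ℝ (Fin n) →L[ℝ] ℝ)
    (F₂ := (EuclideanSpace ℝ (Fin n) →L[ℝ] ℝ) →L[ℝ] ℝ)
    (E₁ := fun y : M ↦ TangentSpace (𝓡 n) y →L[ℝ] Bundle.Trivial M ℝ y)
    (E₂ := fun y : M ↦ (TangentSpace (𝓡 n) y →L[ℝ] Bundle.Trivial M ℝ y) →L[ℝ]
      Bundle.Trivial M ℝ y) fun μ hμ ↦ ?_
  refine contMDiffAt_hom_of_apply (F₁ := EuclideanSpace ℝ (Fin n) →L[ℝ] ℝ) (F₂ := ℝ)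
    (E₁ := fun y : M ↦ TangentSpace (𝓡 n) y →L[ℝ] Bundle.Trivial M ℝ y)
    (E₂ := Bundle.Trivial M ℝ) fun ν hν ↦ ?_
  exact contMDiffAt_totalSpace.2 ⟨contMDiffAt_id, h μ ν hμ hν⟩

theorem contMDiffAt_covector_apply
    {μ : ∀ x : M, TangentSpace (𝓡 n) x →L[ℝ] ℝ} {X : ∀ x : M, TangentSpace (𝓡 n) x} {x : M}
    (hμ : ContMDiffAt (𝓡 n) ((𝓡 n).prod 𝓘(ℝ, EuclideanSpace ℝ (Fin n) →L[ℝ] ℝ)) ∞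
      (fun y ↦ TotalSpace.mk' (EuclideanSpace ℝ (Fin n) →L[ℝ] ℝ)
        (E := fun y : M ↦ TangentSpace (𝓡 n) y →L[ℝ] ℝ) y (μ y)) x)
    (hX : ContMDiffAt (𝓡 n) ((𝓡 n).prod 𝓘(ℝ, EuclideanSpace ℝ (Fin n))) ∞
      (fun y ↦ TotalSpace.mk' (EuclideanSpace ℝ (Fin n)) y (X y)) x) :
    ContMDiffAt (𝓡 n) 𝓘(ℝ, ℝ) ∞ (fun y ↦ μ y (X y)) x := by
  have h : ContMDiffAt (𝓡 n) ((𝓡 n).prod 𝓘(ℝ, ℝ)) ∞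
      (fun y ↦ TotalSpace.mk' ℝ (E := Bundle.Trivial M ℝ) y (μ y (X y))) x :=
    ContMDiffAt.clm_bundle_apply (F₁ := EuclideanSpace ℝ (Fin n)) hμ hX
  exact (contMDiffAt_totalSpace.1 h).2

namespace CourantAlgebroid

variable (A : CourantAlgebroid n F E) (J : AlmostParaHermitianStructure A.toBundleMetric)

theorem anchor_coanchor {A : CourantAlgebroid n F E} (hA : A.IsExact) (x : M)
    (μ : TangentSpace (𝓡 n) x →L[ℝ] ℝ) : A.anchor x (A.coanchor x μ) = 0 :=
  ((hA x).2.1 _).2 ⟨μ, rfl⟩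

theorem anchor_prMinus_coanchor {A : CourantAlgebroid n F E} (hA : A.IsExact)
    (J : AlmostParaHermitianStructure A.toBundleMetric) (x : M)
    (μ : TangentSpace (𝓡 n) x →L[ℝ] ℝ) :
    A.anchor x (J.prMinus x (A.coanchor x μ)) = -A.anchor x (J.prPlus x (A.coanchor x μ)) := by
  rw [eq_neg_iff_add_eq_zero, ← map_add, add_comm, J.prPlus_add_prMinus, anchor_coanchor hA]

theorem anchor_prMinus_coanchor_swap {A : CourantAlgebroid n F E} (hA : A.IsExact)
    (J : AlmostParaHermitianStructure A.toBundleMetric) (x : M)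
    (μ ν : TangentSpace (𝓡 n) x →L[ℝ] ℝ) :
    ν (A.anchor x (J.prMinus x (A.coanchor x μ))) =
      -μ (A.anchor x (J.prMinus x (A.coanchor x ν))) := by
  have h0 (μ ν : TangentSpace (𝓡 n) x →L[ℝ] ℝ) :
      ν (A.anchor x (J.prMinus x (A.coanchor x μ))) =
        -(1 / 2 : ℝ) * A.inner x (A.coanchor x ν) (J.toFun x (A.coanchor x μ)) := by
    rw [A.inner_coanchor, J.prMinus_apply, map_smul, map_sub, anchor_coanchor hA, zero_sub,
      smul_neg, map_neg, map_smul, smul_eq_mul, neg_mul]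
  rw [h0, h0, J.inner_apply_right x (A.coanchor x ν)]
  ring

/-- The bivector field `π` with `ι_μ π = ρ(pr₋(ρ* μ))`. -/
def bivector {A : CourantAlgebroid n F E} (hA : A.IsExact)
    (J : AlmostParaHermitianStructure A.toBundleMetric) : BivectorField M n where
  toFun x :=
    have : FiniteDimensional ℝ (TangentSpace (𝓡 n) x →L[ℝ] ℝ) :=
      inferInstanceAs (FiniteDimensional ℝ (EuclideanSpace ℝ (Fin n) →L[ℝ] ℝ))
    LinearMap.toContinuousBilinearMap <| LinearMap.mk₂ ℝ
      (fun μ ν : TangentSpace (𝓡 n) x →L[ℝ] ℝ ↦ ν (A.anchor x (J.prMinus x (A.coanchor x μ))))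
      (by simp) (by simp) (by simp) (by simp)
  alternating x μ := self_eq_neg.1 (anchor_prMinus_coanchor_swap hA J x μ μ)
  contMDiff x := by
    refine contMDiffAt_bivector fun μ ν hμ hν ↦ ?_
    exact contMDiffAt_covector_apply hν (A.contMDiffAt_anchor (J.contMDiffAt_prMinus
      (A.contMDiffAt_coanchor fun X hX ↦ contMDiffAt_covector_apply hμ hX)))

theorem bivector_apply {A : CourantAlgebroid n F E} (hA : A.IsExact)
    (J : AlmostParaHermitianStructure A.toBundleMetric) (x : M)
    (μ ν : TangentSpace (𝓡 n) x →L[ℝ] ℝ) :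
    (bivector hA J).toFun x μ ν = ν (A.anchor x (J.prMinus x (A.coanchor x μ))) := rfl

theorem bivector_onFunctions {A : CourantAlgebroid n F E} (hA : A.IsExact)
    (J : AlmostParaHermitianStructure A.toBundleMetric) (f h : C^∞⟮𝓡 n, M; ℝ⟯) :
    (bivector hA J).onFunctions f h = A.act (J.minusPart (A.grad f)) h := rfl

theorem act_plusPart_grad {A : CourantAlgebroid n F E} (hA : A.IsExact)
    (J : AlmostParaHermitianStructure A.toBundleMetric) (f h : C^∞⟮𝓡 n, M; ℝ⟯) :
    A.act (J.plusPart (A.grad f)) h = -A.act (J.minusPart (A.grad f)) h := by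
  ext x
  have h1 := anchor_prMinus_coanchor hA J x (differential n f x)
  change A.act _ h x = -A.act _ h x
  rw [act_apply, act_apply, J.plusPart_apply, J.minusPart_apply, ← map_neg]
  exact congrArg _ (neg_eq_iff_eq_neg.2 h1).symm

theorem act_neg (a : Cₛ^∞⟮𝓡 n; F, E⟯) (f : C^∞⟮𝓡 n, M; ℝ⟯) : A.act a (-f) = -A.act a f := by
  ext x
  change differential n (-⇑f) x _ = -differential n f x _
  exact congrArg (fun l : TangentSpace (𝓡 n) x →L[ℝ] ℝ ↦ l _) mfderiv_neg

theorem act_minusPart_grad_swap {A : CourantAlgebroid n F E} (hA : A.IsExact)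
    (J : AlmostParaHermitianStructure A.toBundleMetric) (f h : C^∞⟮𝓡 n, M; ℝ⟯) :
    A.act (J.minusPart (A.grad f)) h = -A.act (J.minusPart (A.grad h)) f := by
  ext x
  exact anchor_prMinus_coanchor_swap hA J x (differential n f x) (differential n h x)

/-- With `{f, h} = π(df, dh)`, both sides are the Jacobiator `{f, {h, k}} + c.p.`. -/
theorem half_schoutenBracket_bivector [T2Space M] {A : CourantAlgebroid n F E} (hA : A.IsExact)
    (J : AlmostParaHermitianStructure A.toBundleMetric) (f h k : C^∞⟮𝓡 n, M; ℝ⟯) (x : M) :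
    (1 / 2 : ℝ) * schoutenBracket (bivector hA J) (bivector hA J) f h k x =
      A.plusForm J (A.grad f) (A.grad h) (A.grad k) x +
        A.plusForm J.neg (A.grad f) (A.grad h) (A.grad k) x := by
  have key := A.inner_bracket_add_inner_bracket f h k (J.plusPart_add_minusPart (A.grad f))
    (J.plusPart_add_minusPart (A.grad h)) (J.plusPart_add_minusPart (A.grad k)) x
  have hneg : J.neg.plusPart = J.minusPart := J.plusPart_neg
  rw [plusForm, plusForm, hneg, key]
  simp only [schoutenBracket, bivector_onFunctions, act_plusPart_grad hA, act_neg]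
  -- The iterated brackets in the definition of the Schouten bracket are `{f, {h, k}}`,
  -- `{h, {k, f}}` and `{k, {f, h}}`.
  rw [act_minusPart_grad_swap hA J h f, act_minusPart_grad_swap hA J f k]
  simp only [act_neg, ContMDiffMap.coe_neg, Pi.neg_apply]
  ring

theorem plusForm_eq_zero_of_closed {A : CourantAlgebroid n F E}
    {J : AlmostParaHermitianStructure A.toBundleMetric}
    (h : ∀ a b : Cₛ^∞⟮𝓡 n; F, E⟯, J.IsPlus a → J.IsPlus b → J.IsPlus (A.bracket a b))
    (a b c : Cₛ^∞⟮𝓡 n; F, E⟯) (x : M) : A.plusForm J a b c x = 0 :=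
  J.inner_eq_zero_of_plus (h _ _ (J.isPlus_plusPart a) (J.isPlus_plusPart b) x)
    (J.isPlus_plusPart c x)

theorem IsParaHermitian.isPoisson [T2Space M] {A : CourantAlgebroid n F E} (hA : A.IsExact)
    {J : AlmostParaHermitianStructure A.toBundleMetric} (h : A.IsParaHermitian J) :
    (bivector hA J).IsPoisson := fun f g k x ↦ by
  have hiff {s : ∀ x, E x} : J.neg.IsPlus s ↔ J.IsMinus s :=
    forall_congr' fun y ↦ (neg_eq_iff_eq_neg : -J.toFun y (s y) = s y ↔ _)
  have key := half_schoutenBracket_bivector hA J f g k x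
  rw [plusForm_eq_zero_of_closed (fun a b ↦ (h a b).1),
    plusForm_eq_zero_of_closed (J := J.neg) fun a b ha hb ↦
      hiff.2 ((h a b).2 (hiff.1 ha) (hiff.1 hb))] at key
  linarith

theorem IsParaHolomorphic.bivector_eq_zero {A : CourantAlgebroid n F E} (hA : A.IsExact)
    {J : AlmostParaHermitianStructure A.toBundleMetric}
    {K : ParaComplexStructure n (EuclideanSpace ℝ (Fin n)) (TangentSpace (𝓡 n) : M → Type _)}
    (h : A.IsParaHolomorphic J K) (x : M) : (bivector hA J).toFun x = 0 := by
  ext μ ν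
  rw [bivector_apply, J.prMinus_apply, map_smul, map_sub, h.2, anchor_coanchor hA]
  simp

end CourantAlgebroid

end Courant

end CourantGeometry

end

theorem mainTheorem9 {n : ℕ} {M : Type*}
    [TopologicalSpace M] [T2Space M] [SecondCountableTopology M]
    [ChartedSpace (EuclideanSpace ℝ (Fin n)) M] [IsManifold (𝓡 n) ∞ M]
    {F : Type*} [NormedAddCommGroup F] [NormedSpace ℝ F] [FiniteDimensional ℝ F]
    {E : M → Type*} [∀ x, AddCommGroup (E x)] [∀ x, Module ℝ (E x)]
    [∀ x, TopologicalSpace (E x)] [TopologicalSpace (TotalSpace F E)]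
    [∀ x, IsTopologicalAddGroup (E x)] [∀ x, ContinuousSMul ℝ (E x)]
    [FiberBundle F E] [VectorBundle ℝ F E] [ContMDiffVectorBundle ∞ F E (𝓡 n)]
    -- the para-Hermitian manifold `(M, g, K)`
    (g : CourantGeometry.BundleMetric n (EuclideanSpace ℝ (Fin n))
      (TangentSpace (𝓡 n) : M → Type _))
    (K : CourantGeometry.AlmostParaHermitianStructure g)
    (hK : CourantGeometry.IsIntegrableOnTangent K.toParaComplexStructure)
    -- the exact almost para-Hermitian algebroid `(E, J)`
    (A : CourantGeometry.CourantAlgebroid n F E) (hA : A.IsExact)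
    (J : CourantGeometry.AlmostParaHermitianStructure A.toBundleMetric) :
    ∃ P : CourantGeometry.BivectorField M n,
      -- `ι_μ π = ρ (pr₋ (ρ* μ)) = - ρ (pr₊ (ρ* μ))`
      (∀ (x : M) (μ ν : TangentSpace (𝓡 n) x →L[ℝ] ℝ),
        P.toFun x μ ν = ν (A.anchor x (J.prMinus x (A.coanchor x μ))) ∧
        P.toFun x μ ν = ν (- A.anchor x (J.prPlus x (A.coanchor x μ)))) ∧
      -- `[π, π] / 2 = ρ(φ) + ρ(ψ)`
      (∃ φ ψ : ∀ x, E x [⋀^Fin 3]→ₗ[ℝ] ℝ,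
        A.IsPlusObstruction J φ ∧ A.IsMinusObstruction J ψ ∧
        ∀ (f h k : C^∞⟮𝓡 n, M; ℝ⟯) (x : M),
          (1 / 2 : ℝ) * CourantGeometry.schoutenBracket P P f h k x =
            A.anchorPush φ x (CourantGeometry.differential n f x)
              (CourantGeometry.differential n h x) (CourantGeometry.differential n k x) +
            A.anchorPush ψ x (CourantGeometry.differential n f x)
              (CourantGeometry.differential n h x) (CourantGeometry.differential n k x)) ∧
      (A.IsParaHermitian J → P.IsPoisson) ∧
      (A.IsParaHolomorphic J K.toParaComplexStructure → ∀ x, P.toFun x = 0) := by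
  have hJ := CourantGeometry.CourantAlgebroid.anchor_prMinus_coanchor hA J
  obtain ⟨φ, hφ, hφ'⟩ := A.exists_plusObstruction J
  obtain ⟨ψ, hψ, hψ'⟩ := A.exists_plusObstruction J.neg
  refine ⟨CourantGeometry.CourantAlgebroid.bivector hA J, fun x μ ν ↦ ⟨rfl, ?_⟩,
    ⟨φ, ψ, hφ, hψ.of_neg, fun f h k x ↦ ?_⟩, fun h ↦ h.isPoisson hA,
    fun h x ↦ h.bivector_eq_zero hA x⟩
  · rw [← hJ]
    rfl
  · rw [CourantGeometry.CourantAlgebroid.half_schoutenBracket_bivector hA J f h k x, ← hφ', ← hψ']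
    rfl
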